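/- Let $\mathcal S(\mathbb R)$ be the Schwartz space of smooth rapidly decreasing functions $f:\mathbb R\to\mathbb C$ with its usual Fréchet topology. A function $\varphi:\mathbb R\to\mathbb R$ is called a symbol for $\mathcal S(\mathbb R)$ if $C_\varphi: f\mapsto f\circ\varphi$ maps $\mathcal S(\mathbb R)$ continuously into itself. For $n\in\mathbb N=\{1,2,\dots\}$ let $\varphi_n=\varphi\circ\cdots\circ\varphi$ denote the $n$-th iterate of $\varphi$. A continuous linear operator $T$ on $\mathcal S(\mathbb R)$ is called power bounded if $\{T^n : n\in\mathbb N\}$ is equicontinuous. For every symbol $\varphi$ for $\mathcal S(\mathbb R)$, the composition operator $C_\varphi:\mathcal S(\mathbb R)\to\mathcal S(\mathbb R)$ is power bounded if and only if both of the following conditions hold: (i) for every integer $j\ge 0$ there exist $C,p>0$ such that $$\left|(\varphi_n)^{(j)}(x)\right|\le C\,\bigl(1+\varphi_n(x)^2\bigr)^p\qquad\text{for all } x\in\mathbb R \text{ and all } n\in\mathbb N;$$ (ii) there exists $k>0$ such that $|\varphi_n(x)|\ge |x|^{1/k}$ for all $x\in\mathbb R$ with $|x|\ge k$ and all $n\in\mathbb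 N$. -/

import Mathlib

open scoped SchwartzMap

/-- A function `φ : ℝ → ℝ` is a symbol for the Schwartz space `𝓢(ℝ)` of complex-valued rapidly
decreasing functions if `f ↦ f ∘ φ` maps `𝓢(ℝ)` continuously into itself. -/
def IsSchwartzSymbol (φ : ℝ → ℝ) : Prop :=
  ∃ T : 𝓢(ℝ, ℂ) →L[ℂ] 𝓢(ℝ, ℂ), ∀ (f : 𝓢(ℝ, ℂ)) (x : ℝ), T f x = f (φ x)

/-- The composition operator `C_φ : 𝓢(ℝ) → 𝓢(ℝ)`, `f ↦ f ∘ φ`, of a symbol `φ`; it is determined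
by `compositionOperator_apply`. -/
noncomputable def compositionOperator (φ : ℝ → ℝ) (hφ : IsSchwartzSymbol φ) :
    𝓢(ℝ, ℂ) →L[ℂ] 𝓢(ℝ, ℂ) :=
  hφ.choose

theorem compositionOperator_apply (φ : ℝ → ℝ) (hφ : IsSchwartzSymbol φ) (f : 𝓢(ℝ, ℂ)) (x : ℝ) :
    compositionOperator φ hφ f x = f (φ x) :=
  hφ.choose_spec f x

/-- A continuous linear operator `T` is power bounded if its powers `T ^ n`, `n = 1, 2, 3, …`,
form an equicontinuous set of operators. -/
def IsPowerBounded {E : Type*} [AddCommGroup E] [Module ℂ E] [UniformSpace E]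
    (T : E →L[ℂ] E) : Prop :=
  Equicontinuous (fun n : ℕ+ => (⇑(T ^ (n : ℕ)) : E → E))

/-!
By `isPowerBounded_iff_seminorm_le`, power boundedness of `C_φ` means that every Schwartz seminorm
of `f ∘ φⁿ` is bounded, uniformly in `n ≥ 1`, by a multiple of finitely many Schwartz seminorms
of `f`.

Necessity comes from testing these estimates at a point `x` on the translates `f = h(· - φⁿ(x))` of
one fixed Schwartz function `h` with `h(z) = 1 + z` near `0`. The seminorms of the translate by `a`
grow at most polynomially in `a` (`seminorm_compSubConstCLM_le`), while `f ∘ φⁿ = 1 + φⁿ - φⁿ(x)`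
near `x`: its value at `x` is `1` and its higher derivatives are those of `φⁿ`. Hence
`IsSchwartzSymbol.norm_iteratedDeriv_le` yields both conditions: derivatives of order `j ≥ 1`
without weight give the derivative bounds (trivial for `j = 0`), and the value with weight `|x|`
gives `|x| ≤ C (1 + |φⁿ(x)|) ^ N`, which is the growth condition.

Sufficiency is the Faà di Bruno estimate `pow_mul_norm_iteratedFDeriv_comp_le`: the growth condition
bounds the weight `|x| ^ k`, and the derivative condition the derivatives of `φⁿ` at `x`, by powers
of `1 + |φⁿ(x)|`, which are absorbed by the decay of the derivatives of `f` at `φⁿ(x)`. It needs `φ`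
to be smooth, which is automatic for symbols (`IsSchwartzSymbol.contDiff`).
-/

open scoped ContDiff Topology

/-! ### Power boundedness in terms of Schwartz seminorms -/

/-- Equicontinuity of the powers, spelled out with the Schwartz seminorms. The finite sets of
seminorms on the right-hand side can be taken to be the boxes `{(i, j) | i ≤ N, j ≤ N}`. -/
theorem isPowerBounded_iff_seminorm_le (T : 𝓢(ℝ, ℂ) →L[ℂ] 𝓢(ℝ, ℂ)) :
    IsPowerBounded T ↔ ∀ k m : ℕ, ∃ (C : ℝ) (N : ℕ), 0 ≤ C ∧ ∀ (n : ℕ) (f : 𝓢(ℝ, ℂ)), 1 ≤ n →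
      SchwartzMap.seminorm ℂ k m ((T ^ n) f) ≤
        C * (Finset.Iic (N, N)).sup (schwartzSeminormFamily ℂ ℝ ℂ) f := by
  have hS := schwartz_withSeminorms ℂ ℝ ℂ
  have key : IsPowerBounded T ↔ ∀ i : ℕ × ℕ, ∃ p : Seminorm ℂ 𝓢(ℝ, ℂ), Continuous p ∧
      ∀ n : ℕ+, (schwartzSeminormFamily ℂ ℝ ℂ i).comp
        ((T ^ (n : ℕ) : 𝓢(ℝ, ℂ) →L[ℂ] 𝓢(ℝ, ℂ)) : 𝓢(ℝ, ℂ) →ₗ[ℂ] 𝓢(ℝ, ℂ)) ≤ p :=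
    (hS.equicontinuous_TFAE
      (fun n : ℕ+ => ((T ^ (n : ℕ) : 𝓢(ℝ, ℂ) →L[ℂ] 𝓢(ℝ, ℂ)) : 𝓢(ℝ, ℂ) →ₗ[ℂ] 𝓢(ℝ, ℂ)))).out 1 3
  rw [key]
  constructor
  · intro H k m
    obtain ⟨p, hp, hle⟩ := H (k, m)
    obtain ⟨s, C, -, hC⟩ := Seminorm.bound_of_continuous hS p hp
    have hs : s ⊆ Finset.Iic (s.sup Prod.fst + s.sup Prod.snd,
        s.sup Prod.fst + s.sup Prod.snd) := fun i hi => by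
      have h1 := Finset.le_sup (f := Prod.fst) hi
      have h2 := Finset.le_sup (f := Prod.snd) hi
      exact Finset.mem_Iic.2 ⟨by dsimp only; omega, by dsimp only; omega⟩
    refine ⟨C, s.sup Prod.fst + s.sup Prod.snd, C.2, fun n f hn => ?_⟩
    refine (hle ⟨n, hn⟩ f).trans ((hC f).trans ?_)
    exact mul_le_mul_of_nonneg_left
      (Seminorm.le_def.1 (Finset.sup_mono (f := schwartzSeminormFamily ℂ ℝ ℂ) hs) f) C.2
  · rintro H ⟨k, m⟩
    obtain ⟨C, N, hC, hle⟩ := H k m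
    have hcont : Continuous (⇑((Finset.Iic (N, N)).sup (schwartzSeminormFamily ℂ ℝ ℂ))) :=
      Seminorm.continuous_finsetSup fun i _ => hS.continuous_seminorm i
    refine ⟨Real.toNNReal C • (Finset.Iic (N, N)).sup (schwartzSeminormFamily ℂ ℝ ℂ),
      hcont.const_smul C.toNNReal, fun n f => ?_⟩
    have h := hle n f n.pos
    rw [← Real.coe_toNNReal C hC] at h
    exact h

theorem compositionOperator_pow_apply (φ : ℝ → ℝ) (hφ : IsSchwartzSymbol φ) (n : ℕ)
    (f : 𝓢(ℝ, ℂ)) (x : ℝ) : (compositionOperator φ hφ ^ n) f x = f (φ^[n] x) := by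
  induction n generalizing x with
  | zero => simp
  | succ n ih =>
    rw [pow_succ', mul_apply_eq_comp, compositionOperator_apply, ih,
      Function.iterate_succ_apply]

/-! ### Test functions -/

theorem exists_schwartzMap_eq_ofReal (g : ℝ → ℝ) (hg : ContDiff ℝ ∞ g)
    (hc : HasCompactSupport g) : ∃ f : 𝓢(ℝ, ℂ), ∀ x, f x = (g x : ℂ) :=
  ⟨HasCompactSupport.toSchwartzMap (f := fun x => (g x : ℂ))
    (hc.comp_left (g := fun y : ℝ => (y : ℂ)) Complex.ofReal_zero)
    (Complex.ofRealCLM.contDiff.comp hg), fun _ => rfl⟩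

/-- A Schwartz function equal to `z ↦ 1 + z` near the origin. -/
theorem exists_schwartzMap_eventually_one_add :
    ∃ f : 𝓢(ℝ, ℂ), ∀ᶠ z in 𝓝 (0 : ℝ), f z = ((1 + z : ℝ) : ℂ) := by
  let χ : ContDiffBump (0 : ℝ) := ⟨1, 2, one_pos, one_lt_two⟩
  obtain ⟨f, hf⟩ := exists_schwartzMap_eq_ofReal (fun z => χ z * (1 + z))
    (χ.contDiff.mul (contDiff_const.add contDiff_id)) χ.hasCompactSupport.mul_right
  exact ⟨f, by filter_upwards [χ.eventuallyEq_one] with z hz; simp [hf, hz]⟩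

/-- The Schwartz seminorms of the translate of `h` by `a` grow at most polynomially in `a`. -/
theorem seminorm_compSubConstCLM_le (h : 𝓢(ℝ, ℂ)) (N : ℕ) : ∃ C : ℝ, 0 ≤ C ∧ ∀ a : ℝ,
    (Finset.Iic (N, N)).sup (schwartzSeminormFamily ℂ ℝ ℂ) (h.compSubConstCLM ℂ a) ≤
      C * (1 + |a|) ^ N := by
  have hC : 0 ≤ 2 ^ N * (Finset.Iic (N, N)).sup (schwartzSeminormFamily ℂ ℝ ℂ) h := by positivity
  refine ⟨_, hC, fun a => Seminorm.finset_sup_apply_le (by positivity) ?_⟩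
  rintro ⟨i, j⟩ hij
  obtain ⟨hi : i ≤ N, hj : j ≤ N⟩ := Finset.mem_Iic.1 hij
  refine SchwartzMap.seminorm_le_bound ℂ i j _ (by positivity) fun x => ?_
  have hx : ‖x‖ ≤ (1 + ‖x - a‖) * (1 + |a|) := by
    have : ‖x‖ ≤ ‖x - a‖ + ‖a‖ := by simpa using norm_add_le (x - a) a
    simp only [Real.norm_eq_abs] at *
    nlinarith [abs_nonneg a, abs_nonneg (x - a), mul_nonneg (abs_nonneg a) (abs_nonneg (x - a))]
  have hd : iteratedFDeriv ℝ j (h.compSubConstCLM ℂ a) x = iteratedFDeriv ℝ j h (x - a) :=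
    iteratedFDeriv_comp_sub j a x
  have hb := SchwartzMap.one_add_le_sup_seminorm_apply (𝕜 := ℂ) (m := (N, N)) hi hj h (x - a)
  rw [hd]
  calc ‖x‖ ^ i * ‖iteratedFDeriv ℝ j h (x - a)‖
      ≤ ((1 + ‖x - a‖) * (1 + |a|)) ^ i * ‖iteratedFDeriv ℝ j h (x - a)‖ := by gcongr
    _ = ((1 + ‖x - a‖) ^ i * ‖iteratedFDeriv ℝ j h (x - a)‖) * (1 + |a|) ^ i := by
        rw [mul_pow]; ring
    _ ≤ _ := mul_le_mul hb (pow_le_pow_right₀ (by linarith [abs_nonneg a]) hi)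
        (by positivity) hC

/-! ### Symbols are smooth -/

theorem IsSchwartzSymbol.contDiff_comp {φ : ℝ → ℝ} (hφ : IsSchwartzSymbol φ) (f : 𝓢(ℝ, ℂ)) :
    ContDiff ℝ ∞ fun x => f (φ x) := by
  obtain ⟨T, hT⟩ := hφ
  simpa only [← hT] using! (T f).smooth ⊤

/-- Near `x`, the symbol is the quotient `φ = φ x + g (φ - φ x) / f (φ - φ x)`, where `f` is a bump
function around `0` and `g z = f z * z`; numerator and denominator are compositions of `φ` with
translated Schwartz functions. -/
theorem IsSchwartzSymbol.contDiff {φ : ℝ → ℝ} (hφ : IsSchwartzSymbol φ) : ContDiff ℝ ∞ φ := by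
  let χ : ContDiffBump (0 : ℝ) := ⟨1, 2, one_pos, one_lt_two⟩
  obtain ⟨f, hf⟩ := exists_schwartzMap_eq_ofReal χ χ.contDiff χ.hasCompactSupport
  obtain ⟨g, hg⟩ := exists_schwartzMap_eq_ofReal (fun z => χ z * z)
    (χ.contDiff.mul contDiff_id) χ.hasCompactSupport.mul_right
  rw [contDiff_iff_contDiffAt]
  intro x
  have h1 : ContDiff ℝ ∞ fun y => χ (φ y - φ x) := by
    simpa [Function.comp_def, hf] using
      Complex.reCLM.contDiff.comp (hφ.contDiff_comp (f.compSubConstCLM ℂ (φ x)))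
  have h2 : ContDiff ℝ ∞ fun y => χ (φ y - φ x) * (φ y - φ x) := by
    simpa [Function.comp_def, hg] using
      Complex.reCLM.contDiff.comp (hφ.contDiff_comp (g.compSubConstCLM ℂ (φ x)))
  have h0 : χ (φ x - φ x) ≠ 0 := by simp [χ.eventuallyEq_one.eq_of_nhds]
  have hq := (contDiffAt_const (c := φ x)).add (h2.contDiffAt.div h1.contDiffAt h0)
  refine hq.congr_of_eventuallyEq ?_
  filter_upwards [h1.continuous.continuousAt.eventually_ne h0] with y hy
  simp [mul_div_cancel_left₀ _ hy]

theorem IsSchwartzSymbol.contDiff_iterate {φ : ℝ → ℝ} (hφ : IsSchwartzSymbol φ) (n : ℕ) :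
    ContDiff ℝ ∞ φ^[n] := by
  induction n with
  | zero => exact contDiff_id
  | succ n ih => exact ih.comp hφ.contDiff

/-! ### Necessity -/

/-- The seminorm estimates tested on the translate by `φⁿ(x)` of a fixed Schwartz function that is
equal to `1 + z` near `0`: the composition of this translate with `φⁿ` is `1 - φⁿ(x) + φⁿ`
near `x`. -/
theorem IsSchwartzSymbol.norm_iteratedDeriv_le {φ : ℝ → ℝ} (hφ : IsSchwartzSymbol φ)
    (H : IsPowerBounded (compositionOperator φ hφ)) (k m : ℕ) :
    ∃ (C : ℝ) (N : ℕ), 0 ≤ C ∧ ∀ (n : ℕ) (x : ℝ), 1 ≤ n →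
      |x| ^ k * |iteratedDeriv m (fun y => 1 - φ^[n] x + φ^[n] y) x| ≤
        C * (1 + |φ^[n] x|) ^ N := by
  obtain ⟨h, hh⟩ := exists_schwartzMap_eventually_one_add
  obtain ⟨C, N, hC, hle⟩ := (isPowerBounded_iff_seminorm_le _).1 H k m
  obtain ⟨C', hC', hle'⟩ := seminorm_compSubConstCLM_le h N
  refine ⟨C * C', N, mul_nonneg hC hC', fun n x hn => ?_⟩
  have hsm : ContDiff ℝ ∞ (φ^[n]) := hφ.contDiff_iterate n
  set F := (compositionOperator φ hφ ^ n) (h.compSubConstCLM ℂ (φ^[n] x)) with hF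
  have hFx : F =ᶠ[𝓝 x] (Complex.ofRealLI ∘ fun y => 1 - φ^[n] x + φ^[n] y) := by
    have ht : Filter.Tendsto (fun y => φ^[n] y - φ^[n] x) (𝓝 x) (𝓝 0) := by
      simpa using (hsm.continuous.tendsto x).sub_const (φ^[n] x)
    filter_upwards [ht.eventually hh] with y hy
    rw [hF, compositionOperator_pow_apply, SchwartzMap.compSubConstCLM_apply, hy,
      Function.comp_apply, ← add_sub_assoc, add_sub_right_comm]
    rfl
  have hd : ‖iteratedFDeriv ℝ m F x‖ = |iteratedDeriv m (fun y => 1 - φ^[n] x + φ^[n] y) x| := by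
    rw [(hFx.iteratedFDeriv ℝ m).eq_of_nhds, LinearIsometry.norm_iteratedFDeriv_comp_left _
      (contDiff_const.add hsm).contDiffAt (mod_cast le_top),
      norm_iteratedFDeriv_eq_norm_iteratedDeriv, Real.norm_eq_abs]
  rw [← hd, ← Real.norm_eq_abs x]
  calc _ ≤ SchwartzMap.seminorm ℂ k m F := SchwartzMap.le_seminorm ℂ k m F x
    _ ≤ _ := hle n _ hn
    _ ≤ C * (C' * (1 + |φ^[n] x|) ^ N) := by gcongr; exact hle' _
    _ = _ := by ring

/-- Power boundedness implies the polynomial bounds on the derivatives of the iterates. -/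
theorem IsSchwartzSymbol.iteratedDeriv_iterate_le {φ : ℝ → ℝ} (hφ : IsSchwartzSymbol φ)
    (H : IsPowerBounded (compositionOperator φ hφ)) (j : ℕ) :
    ∃ C p : ℝ, 0 < C ∧ 0 < p ∧ ∀ (n : ℕ) (x : ℝ), 1 ≤ n →
      |iteratedDeriv j (φ^[n]) x| ≤ C * (1 + (φ^[n] x) ^ 2) ^ p := by
  have hlin : ∀ y : ℝ, 1 + |y| ≤ 2 * (1 + y ^ 2) := fun y => by
    nlinarith [sq_abs y, sq_nonneg (|y| - 1)]
  rcases Nat.eq_zero_or_pos j with rfl | hj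
  · refine ⟨2, 1, two_pos, one_pos, fun n x _ => ?_⟩
    rw [iteratedDeriv_zero, Real.rpow_one]
    linarith [hlin (φ^[n] x)]
  · obtain ⟨C, N, hC, hle⟩ := hφ.norm_iteratedDeriv_le H 0 j
    refine ⟨C * 2 ^ N + 1, N + 1, by positivity, by positivity, fun n x hn => ?_⟩
    have h := hle n x hn
    rw [pow_zero, one_mul, iteratedDeriv_const_add hj] at h
    have h1 : 1 ≤ 1 + φ^[n] x ^ 2 := by nlinarith [sq_nonneg (φ^[n] x)]
    calc _ ≤ C * (1 + |φ^[n] x|) ^ N := h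
      _ ≤ C * (2 * (1 + φ^[n] x ^ 2)) ^ N := by gcongr; exact hlin _
      _ = C * 2 ^ N * (1 + φ^[n] x ^ 2) ^ N := by rw [mul_pow]; ring
      _ ≤ (C * 2 ^ N + 1) * (1 + φ^[n] x ^ 2) ^ (N + 1) := by gcongr <;> simp
      _ = _ := by norm_cast

/-- Power boundedness implies that the iterates grow at least like a fixed root of `|x|`. -/
theorem IsSchwartzSymbol.rpow_le_abs_iterate {φ : ℝ → ℝ} (hφ : IsSchwartzSymbol φ)
    (H : IsPowerBounded (compositionOperator φ hφ)) :
    ∃ k : ℝ, 0 < k ∧ ∀ (n : ℕ) (x : ℝ), 1 ≤ n → k ≤ |x| → |x| ^ (1 / k) ≤ |φ^[n] x| := by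
  obtain ⟨C, N, hC, hle⟩ := hφ.norm_iteratedDeriv_le H 1 0
  -- If `|φⁿ(x)| < |x| ^ (1 / k)`, the estimate `|x| ≤ C (1 + |φⁿ(x)|) ^ N` gives
  -- `|x| ≤ C 2 ^ N √|x|` when `k ≥ 2 N`, and so `|x| ≤ (C 2 ^ N) ^ 2 < k`.
  refine ⟨2 * N + 1 + (C * 2 ^ N) ^ 2, by positivity, fun n x hn hx => ?_⟩
  set k : ℝ := 2 * N + 1 + (C * 2 ^ N) ^ 2 with hk
  have hk1 : 2 * N + 1 ≤ k := by rw [hk]; linarith [sq_nonneg (C * 2 ^ N)]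
  have hk0 : 0 < k := by positivity
  have hx1 : 1 ≤ |x| := by linarith [Nat.cast_nonneg (α := ℝ) N]
  by_contra! hlt
  have ht : 1 ≤ |x| ^ (1 / k) := Real.one_le_rpow hx1 (by positivity)
  have h := hle n x hn
  simp only [pow_one, iteratedDeriv_zero, sub_add_cancel, abs_one, mul_one] at h
  have h2 : |x| ≤ C * 2 ^ N * √|x| := by
    calc |x| ≤ C * (1 + |φ^[n] x|) ^ N := h
      _ ≤ C * (2 * |x| ^ (1 / k)) ^ N := by gcongr; linarith
      _ = C * 2 ^ N * |x| ^ (1 / k * N) := by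
        rw [mul_pow, ← Real.rpow_mul_natCast (abs_nonneg x)]; ring
      _ ≤ C * 2 ^ N * |x| ^ (1 / 2 : ℝ) := by
        gcongr
        rw [div_mul_eq_mul_div, one_mul, div_le_div_iff₀ hk0 two_pos]; linarith
      _ = _ := by rw [Real.sqrt_eq_rpow]
  have hs : 0 < √|x| := Real.sqrt_pos.2 (by linarith)
  have hss : √|x| * √|x| = |x| := Real.mul_self_sqrt (abs_nonneg x)
  have h3 : √|x| ≤ C * 2 ^ N := le_of_mul_le_mul_right (hss.trans_le h2) hs
  have h4 : |x| ≤ (C * 2 ^ N) ^ 2 := by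
    rw [← hss, ← sq]; gcongr
  linarith [Nat.cast_nonneg (α := ℝ) N]

/-! ### Sufficiency -/

/-- The derivative bounds of orders `j ≤ m` hold with common constants and an integer exponent. -/
theorem exists_uniform_iteratedDeriv_le {φ : ℝ → ℝ}
    (h : ∀ j : ℕ, ∃ C p : ℝ, 0 < C ∧ 0 < p ∧ ∀ (n : ℕ) (x : ℝ), 1 ≤ n →
      |iteratedDeriv j (φ^[n]) x| ≤ C * (1 + (φ^[n] x) ^ 2) ^ p) (m : ℕ) :
    ∃ (A : ℝ) (P : ℕ), 1 ≤ A ∧ ∀ (j n : ℕ) (x : ℝ), j ≤ m → 1 ≤ n →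
      |iteratedDeriv j (φ^[n]) x| ≤ A * (1 + |φ^[n] x|) ^ P := by
  choose C p hC hp hle using h
  have hCs : 0 ≤ ∑ j ∈ Finset.range (m + 1), C j := Finset.sum_nonneg fun j _ => (hC j).le
  refine ⟨1 + ∑ j ∈ Finset.range (m + 1), C j, 2 * ⌈∑ j ∈ Finset.range (m + 1), p j⌉₊,
    by linarith, fun j n x hj hn => (hle j n x hn).trans ?_⟩
  have hjm : j ∈ Finset.range (m + 1) := by simpa [Nat.lt_succ_iff] using hj
  have hCj := Finset.single_le_sum (fun i _ => (hC i).le) hjm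
  have hpj := (Finset.single_le_sum (fun i _ => (hp i).le) hjm).trans (Nat.le_ceil _)
  set P := ⌈∑ j ∈ Finset.range (m + 1), p j⌉₊
  have h1 : 1 ≤ 1 + φ^[n] x ^ 2 := by nlinarith [sq_nonneg (φ^[n] x)]
  calc C j * (1 + φ^[n] x ^ 2) ^ p j
      ≤ (1 + ∑ j ∈ Finset.range (m + 1), C j) * (1 + φ^[n] x ^ 2) ^ (P : ℝ) := by
        gcongr
        linarith
    _ = (1 + ∑ j ∈ Finset.range (m + 1), C j) * (1 + φ^[n] x ^ 2) ^ P := by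
        rw [Real.rpow_natCast]
    _ ≤ (1 + ∑ j ∈ Finset.range (m + 1), C j) * ((1 + |φ^[n] x|) ^ 2) ^ P := by
        gcongr
        nlinarith [sq_abs (φ^[n] x), abs_nonneg (φ^[n] x)]
    _ = _ := by rw [pow_mul]

/-- The growth condition implies that `x` grows at most polynomially in `φⁿ(x)`, uniformly in `n`. -/
theorem exists_abs_le_of_rpow_le_abs_iterate {φ : ℝ → ℝ}
    (h : ∃ k : ℝ, 0 < k ∧ ∀ (n : ℕ) (x : ℝ), 1 ≤ n → k ≤ |x| → |x| ^ (1 / k) ≤ |φ^[n] x|) :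
    ∃ (B : ℝ) (Q : ℕ), 0 ≤ B ∧ ∀ (n : ℕ) (x : ℝ), 1 ≤ n → |x| ≤ B * (1 + |φ^[n] x|) ^ Q := by
  obtain ⟨k, hk, hle⟩ := h
  refine ⟨k + 1, ⌈k⌉₊, by positivity, fun n x hn => ?_⟩
  have h1 : 1 ≤ 1 + |φ^[n] x| := by linarith [abs_nonneg (φ^[n] x)]
  rcases le_total k |x| with hx | hx
  · calc |x| = (|x| ^ (1 / k)) ^ k := by
          rw [← Real.rpow_mul (abs_nonneg x), one_div_mul_cancel hk.ne', Real.rpow_one]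
      _ ≤ |φ^[n] x| ^ k := by gcongr; exact hle n x hn hx
      _ ≤ (1 + |φ^[n] x|) ^ k := by gcongr; linarith
      _ ≤ (1 + |φ^[n] x|) ^ (⌈k⌉₊ : ℝ) := by
          gcongr
          exact Nat.le_ceil k
      _ = 1 * (1 + |φ^[n] x|) ^ ⌈k⌉₊ := by rw [Real.rpow_natCast, one_mul]
      _ ≤ _ := by gcongr; linarith
  · calc |x| ≤ (k + 1) * 1 := by linarith
      _ ≤ _ := by gcongr; exact one_le_pow₀ h1

/-- The Faà di Bruno estimate: the derivatives of `f ∘ ψ` at `x` are controlled by Schwartz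
seminorms of `f` as soon as `x` and the derivatives of `ψ` at `x` grow at most polynomially
in `ψ x`. -/
theorem pow_mul_norm_iteratedFDeriv_comp_le {ψ : ℝ → ℝ} (hψ : ContDiff ℝ ∞ ψ) {A B x : ℝ}
    {P Q m : ℕ} (k : ℕ) (hA : 1 ≤ A) (hB : 0 ≤ B)
    (hd : ∀ j ≤ m, |iteratedDeriv j ψ x| ≤ A * (1 + |ψ x|) ^ P)
    (hx : |x| ≤ B * (1 + |ψ x|) ^ Q) (f : 𝓢(ℝ, ℂ)) :
    ‖x‖ ^ k * ‖iteratedFDeriv ℝ m (f ∘ ψ) x‖ ≤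
      B ^ k * m.factorial * A ^ m * 2 ^ (Q * k + P * m + m) *
        (Finset.Iic (Q * k + P * m + m, Q * k + P * m + m)).sup
          (schwartzSeminormFamily ℂ ℝ ℂ) f := by
  -- The power of `1 + |ψ x|` that the weight and the derivatives of `ψ` cost in total.
  set M := Q * k + P * m with hM
  set S := (Finset.Iic (M + m, M + m)).sup (schwartzSeminormFamily ℂ ℝ ℂ) f
  set t := 1 + |ψ x| with ht
  have ht1 : 1 ≤ t := by linarith [abs_nonneg (ψ x)]
  have hf : ∀ i ≤ m, ‖iteratedFDeriv ℝ i f (ψ x)‖ ≤ 2 ^ (M + m) * S / t ^ M := fun i hi => by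
    rw [le_div_iff₀' (by positivity)]
    exact SchwartzMap.one_add_le_sup_seminorm_apply (𝕜 := ℂ) (m := (M + m, M + m))
      (Nat.le_add_right M m) (hi.trans (Nat.le_add_left m M)) f (ψ x)
  have hD : ∀ i, 1 ≤ i → i ≤ m → ‖iteratedFDeriv ℝ i ψ x‖ ≤ (A * t ^ P) ^ i := fun i hi him => by
    rw [norm_iteratedFDeriv_eq_norm_iteratedDeriv, Real.norm_eq_abs]
    exact (hd i him).trans (le_self_pow₀ (one_le_mul_of_one_le_of_one_le hA (one_le_pow₀ ht1))
      (by omega))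
  have hcomp := norm_iteratedFDeriv_comp_le (f.smooth ⊤) hψ (mod_cast le_top) x hf hD
  rw [Real.norm_eq_abs]
  calc |x| ^ k * ‖iteratedFDeriv ℝ m (f ∘ ψ) x‖
      ≤ (B * t ^ Q) ^ k * (m.factorial * (2 ^ (M + m) * S / t ^ M) * (A * t ^ P) ^ m) := by gcongr
    _ = B ^ k * m.factorial * A ^ m * 2 ^ (M + m) * S * (t ^ M / t ^ M) := by
        rw [mul_pow, mul_pow, ← pow_mul, ← pow_mul, hM, pow_add t]; ring
    _ = _ := by rw [div_self (by positivity), mul_one]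

theorem mainTheorem3 (φ : ℝ → ℝ) (hφ : IsSchwartzSymbol φ) :
    IsPowerBounded (compositionOperator φ hφ) ↔
      (∀ j : ℕ, ∃ C p : ℝ, 0 < C ∧ 0 < p ∧ ∀ (n : ℕ) (x : ℝ), 1 ≤ n →
        |iteratedDeriv j (φ^[n]) x| ≤ C * (1 + (φ^[n] x) ^ 2) ^ p) ∧
      (∃ k : ℝ, 0 < k ∧ ∀ (n : ℕ) (x : ℝ), 1 ≤ n → k ≤ |x| →
        |x| ^ (1 / k) ≤ |φ^[n] x|) := by
  refine ⟨fun H => ⟨hφ.iteratedDeriv_iterate_le H, hφ.rpow_le_abs_iterate H⟩, ?_⟩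
  rintro ⟨h₁, h₂⟩
  rw [isPowerBounded_iff_seminorm_le]
  intro k m
  obtain ⟨A, P, hA, hder⟩ := exists_uniform_iteratedDeriv_le h₁ m
  obtain ⟨B, Q, hB, habs⟩ := exists_abs_le_of_rpow_le_abs_iterate h₂
  refine ⟨B ^ k * m.factorial * A ^ m * 2 ^ (Q * k + P * m + m), Q * k + P * m + m, by positivity,
    fun n f hn => SchwartzMap.seminorm_le_bound ℂ k m _ (by positivity) fun x => ?_⟩
  have hcomp : ⇑((compositionOperator φ hφ ^ n) f) = f ∘ φ^[n] :=
    funext fun y => compositionOperator_pow_apply φ hφ n f y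
  rw [hcomp]
  exact pow_mul_norm_iteratedFDeriv_comp_le (hφ.contDiff_iterate n) k hA hB
    (fun j hj => hder j n x hj hn) (habs n x hn) f
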